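/- Consider the $K$-armed adversarial bandit game over $T$ rounds. A loss sequence is a family $\ell_{1:T} = (\ell_{i,t})_{1\le i\le K,\,1\le t\le T}$ with values in $[0,1]$, fixed in advance; put $\ell_t = (\ell_{i,t})_{1\le i\le K}$. In each round $t$ a randomised bandit algorithm picks an action $I_t \in \{1,\dots,K\}$ from its internal randomness and its past observations $(I_s, \ell_{I_s,s})_{s<t}$, and then observes only its own loss $\ell_{I_t,t}$. Its regret is $$R_T(\ell_{1:T}) = \sum_{t=1}^T \ell_{I_t,t} - \min_{1\le i\le K} \sum_{t=1}^T \ell_{i,t}.$$ For $\rho \ge 0$ let $\mathcal{C}_\rho = \{x \in [0,1]^K : \max_{i,j}|x_i - x_j| \le \rho\}$. Let $K \ge 2$, $T \ge 32(K-1)\log(14)$ and $\rho \ge 0.22\sqrt{(K-1)/T}$. Then for every randomised bandit algorithm there are $\ell_1,\dots,\ell_T \in \mathcal{C}_\rho$ with $$\mathbb{E}[R_T(\ell_{1:T})] \ge \frac{\sqrt{T(K-1)}}{504},$$ where the expectation is with respect to the internal randomness of the algorithm. In particular, $$\sup_{\ell_1,\dots,\ell_T \in \mathcal{C}_\rho}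 \mathbb{E}[R_T(\ell_{1:T})] \ge \frac{\sqrt{T(K-1)}}{504}.$$ -/

import Mathlib

open MeasureTheory

/-- A randomised algorithm for the `K`-armed bandit game with `T` rounds (indexed by `Fin T`).
All of its internal randomness, including the draw of each action from the distribution that the
algorithm has chosen, is carried by an outcome `ω : Ω` of an auxiliary probability space. In round
`t` it picks `act t ω h`, where the history `h` lists the earlier actions together with the losses
of those actions; the other coordinates of the loss vectors are never seen. -/
structure BanditAlgorithm (K T : ℕ) (Ω : Type*) [MeasurableSpace Ω] where
  act : (t : Fin T) → Ω → (Fin t → Fin K × ℝ) → Fin K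
  measurable_act : ∀ t : Fin T,
    Measurable (fun x : Ω × (Fin t → Fin K × ℝ) => act t x.1 x.2)

namespace BanditAlgorithm

variable {K T : ℕ} {Ω : Type*} [MeasurableSpace Ω]

/-- The action `I_t` that is played in round `t` against the losses `ℓ` (`ℓ t i` is the loss of
arm `i` in round `t`): the algorithm is fed with the history `(I_s, ℓ_{I_s, s})`, `s < t`. -/
def action (A : BanditAlgorithm K T Ω) (ℓ : Fin T → Fin K → ℝ) (ω : Ω) (t : Fin T) : Fin K :=
  A.act t ω (fun s =>
    (A.action ℓ ω ⟨s, s.isLt.trans t.isLt⟩,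
      ℓ ⟨s, s.isLt.trans t.isLt⟩ (A.action ℓ ω ⟨s, s.isLt.trans t.isLt⟩)))
termination_by t.val
decreasing_by all_goals exact s.isLt

/-- The regret `R_T = ∑ₜ ℓ_{I_t, t} - minᵢ ∑ₜ ℓ_{i, t}`. -/
noncomputable def regret (A : BanditAlgorithm K T Ω) (ℓ : Fin T → Fin K → ℝ) (ω : Ω) : ℝ :=
  ∑ t, ℓ t (A.action ℓ ω t) - ⨅ i, ∑ t, ℓ t i

/-- The expected regret on the fixed loss sequence `ℓ`; the expectation is over the internal
randomness of the algorithm, whose law is `P`. -/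
noncomputable def expectedRegret (A : BanditAlgorithm K T Ω) (P : Measure Ω)
    (ℓ : Fin T → Fin K → ℝ) : ℝ :=
  ∫ ω, A.regret ℓ ω ∂P

end BanditAlgorithm

/-- The loss vectors in `[0,1]^K` with effective range at most `ρ`. -/
def lossesOfRange (K : ℕ) (ρ : ℝ) : Set (Fin K → ℝ) :=
  {x | (∀ i, x i ∈ Set.Icc (0 : ℝ) 1) ∧ ∀ i j, |x i - x j| ≤ ρ}

/- All arms share the same noise, uniform on the grid `{0, 1 / N, …, (N - 1) / N}` and drawn afresh
in each round, except that a planted arm `j` may be one grid point lower. The probability of this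
step down, `k (N - k) / N ^ 2` at the point `k / N`, is chosen so that the loss of arm `j` alone
follows a slight linear tilt of the uniform law. The losses of a round then differ by at most
`1 / N`, arm `j` is better than the others by about `1 / (6 N)` per round, and yet each of its plays
reveals a divergence of only about `1 / N ^ 2`, because the learner never sees two losses of the
same round. Hence a learner that plays `j` at most `T / K` times in the unplanted environment
collects a divergence of order `T / (K N ^ 2)`. For `N` of order `√(T / (K - 1))` this is too little
to find the planted arm, and a regret of order `T / N` follows. -/

section FiniteLaws

variable {V W : Type*} [Fintype W]

theorem sum_map_mul [Fintype V] (X : W → V) (r : W → ℝ) (g : V → ℝ) :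
    ∑ v, FunOnFinite.map X r v * g v = ∑ w, r w * g (X w) := by
  classical
  rw [← Finset.sum_fiberwise _ X]
  refine Finset.sum_congr rfl fun v _ => ?_
  rw [FunOnFinite.map_apply_apply, Finset.sum_mul]
  exact Finset.sum_congr rfl fun w hw => by rw [(Finset.mem_filter.1 hw).2]

theorem sum_map [Fintype V] (X : W → V) (r : W → ℝ) :
    ∑ v, FunOnFinite.map X r v = ∑ w, r w := by
  simpa using sum_map_mul X r 1

theorem exists_le_of_le_sum_mul {m f : W → ℝ} {c : ℝ} (hm : m ∈ stdSimplex ℝ W)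
    (hc : c ≤ ∑ w, m w * f w) : ∃ w, c ≤ f w := by
  by_contra! h
  exact hc.not_gt ((convex_Iio c).sum_mem (fun w _ => hm.1 w) hm.2 fun w _ => h w)

/-- The Kullback–Leibler divergence of two laws on a finite type. It is meant for positive `q`:
points with `q v = 0` contribute `0` instead of `∞`. -/
noncomputable def relEntropy (p q : W → ℝ) : ℝ := ∑ v, p v * Real.log (p v / q v)

theorem relEntropy_self (p : W → ℝ) : relEntropy p p = 0 :=
  Finset.sum_eq_zero fun v _ => by rcases eq_or_ne (p v) 0 with h | h <;> simp [h]

theorem relEntropy_le_chiSq {p q : W → ℝ} (hp : ∀ v, 0 < p v) (hq : ∀ v, 0 < q v)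
    (hpq : ∑ v, p v = ∑ v, q v) : relEntropy p q ≤ ∑ v, (p v - q v) ^ 2 / q v := by
  have pointwise : ∀ v, p v * Real.log (p v / q v) ≤ (p v - q v) ^ 2 / q v + (p v - q v) := by
    intro v
    have hv := (hq v).ne'
    calc p v * Real.log (p v / q v) ≤ p v * (p v / q v - 1) :=
          mul_le_mul_of_nonneg_left (Real.log_le_sub_one_of_pos (div_pos (hp v) (hq v))) (hp v).le
      _ = (p v - q v) ^ 2 / q v + (p v - q v) := by field_simp; ring
  calc relEntropy p q ≤ ∑ v, ((p v - q v) ^ 2 / q v + (p v - q v)) :=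
        Finset.sum_le_sum fun v _ => pointwise v
    _ = ∑ v, (p v - q v) ^ 2 / q v := by
        rw [Finset.sum_add_distrib, Finset.sum_sub_distrib, hpq, sub_self, add_zero]

theorem sq_half_le_sub_one_sub_log {x : ℝ} (hx : 0 < x) (hx1 : x ≤ 1) :
    (1 - x) ^ 2 / 2 ≤ x - 1 - Real.log x := by
  have log_bound : 2 * (1 - x) / (1 + x) ≤ -Real.log x := by
    have h := Real.le_log_one_add_of_nonneg (div_nonneg (sub_nonneg.2 hx1) hx.le)
    have reciprocal : 1 + (1 - x) / x = x⁻¹ := by field_simp; ring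
    rw [reciprocal, Real.log_inv] at h
    refine le_of_eq_of_le ?_ h
    have hx' : 1 - x + 2 * x ≠ 0 := by linarith
    field_simp
    ring
  have rational_bound : (1 - x) ^ 2 / 2 + (1 - x) ≤ 2 * (1 - x) / (1 + x) := by
    rw [le_div_iff₀ (by linarith)]
    nlinarith [pow_nonneg (sub_nonneg.2 hx1) 3]
  linarith

theorem max_one_sub_le {x c : ℝ} (hx : 0 < x) (hc : 0 < c) :
    max (1 - x) 0 ≤ c / 2 + (x - 1 - Real.log x) / c := by
  have hlog : 0 ≤ x - 1 - Real.log x := by linarith [Real.log_le_sub_one_of_pos hx]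
  refine max_le ?_ (by positivity)
  rcases le_total x 1 with h | h
  · calc 1 - x ≤ c / 2 + (1 - x) ^ 2 / 2 / c := by
          rw [← sub_nonneg]
          have square : c / 2 + (1 - x) ^ 2 / 2 / c - (1 - x) = (c - (1 - x)) ^ 2 / (2 * c) := by
            field_simp
            ring
          rw [square]
          positivity
      _ ≤ c / 2 + (x - 1 - Real.log x) / c := by gcongr; exact sq_half_le_sub_one_sub_log hx h
  · exact (sub_nonpos.2 h).trans (by positivity)

/-- Pinsker's inequality in the form that results from `√(2D) ≤ c / 2 + D / c`; unlike the square
root, the right-hand side is linear in the divergence `D` and can be summed. -/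
theorem sum_mul_le_sum_mul_add_relEntropy {p q f : W → ℝ} {B c : ℝ} (hp : ∀ v, 0 < p v)
    (hq : ∀ v, 0 < q v) (hp1 : ∑ v, p v = 1) (hq1 : ∑ v, q v = 1)
    (hf : ∀ v, f v ∈ Set.Icc 0 B) (hc : 0 < c) :
    ∑ v, q v * f v ≤ ∑ v, p v * f v + B * (c / 2 + relEntropy p q / c) := by
  have pointwise : ∀ v, q v * f v ≤ p v * f v +
      B * (q v - p v + p v * (c / 2) + (q v - p v + p v * Real.log (p v / q v)) / c) := by
    intro v
    obtain ⟨hf0, hfB⟩ := hf v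
    have hpv := (hp v).ne'
    have mass_loss : (p v - q v) * (B - f v) ≤
        B * (p v * (c / 2 + (q v / p v - 1 - Real.log (q v / p v)) / c)) :=
      calc (p v - q v) * (B - f v) = p v * ((1 - q v / p v) * (B - f v)) := by field_simp
        _ ≤ p v * (max (1 - q v / p v) 0 * B) :=
            mul_le_mul_of_nonneg_left (mul_le_mul (le_max_left _ _) (by linarith) (by linarith)
              (le_max_right _ _)) (hp v).le
        _ ≤ p v * ((c / 2 + (q v / p v - 1 - Real.log (q v / p v)) / c) * B) :=
            mul_le_mul_of_nonneg_left (mul_le_mul_of_nonneg_right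
              (max_one_sub_le (div_pos (hq v) (hp v)) hc) (hf0.trans hfB)) (hp v).le
        _ = _ := by ring
    have hlog : Real.log (q v / p v) = -Real.log (p v / q v) := by rw [← Real.log_inv, inv_div]
    have hscale : p v * (c / 2 + (q v / p v - 1 - Real.log (q v / p v)) / c) =
        p v * (c / 2) + (q v - p v + p v * Real.log (p v / q v)) / c := by
      rw [hlog]
      field_simp
      ring
    rw [hscale] at mass_loss
    linarith
  refine (Finset.sum_le_sum fun v _ => pointwise v).trans_eq ?_
  rw [Finset.sum_add_distrib, ← Finset.mul_sum, Finset.sum_add_distrib, Finset.sum_add_distrib,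
    ← Finset.sum_div, Finset.sum_add_distrib, Finset.sum_sub_distrib, ← Finset.sum_mul, hp1, hq1,
    relEntropy]
  ring

end FiniteLaws

section IidLaw

variable {ι W : Type*} [Fintype ι]

/-- The law of a family of independent draws, one for each `t : ι`, from the law `r`. -/
def iidLaw (r : W → ℝ) (w : ι → W) : ℝ := ∏ t, r (w t)

theorem iidLaw_mul_update [DecidableEq ι] (r : W → ℝ) (t : ι) (w : ι → W) (u : W) :
    r (w t) * iidLaw r (Function.update w t u) = r u * iidLaw r w := by
  have others : ∏ s ∈ Finset.univ.erase t, r (Function.update w t u s) =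
      ∏ s ∈ Finset.univ.erase t, r (w s) :=
    Finset.prod_congr rfl fun s hs => by rw [Function.update_of_ne (Finset.ne_of_mem_erase hs)]
  rw [iidLaw, iidLaw, ← Finset.mul_prod_erase _ _ (Finset.mem_univ t),
    ← Finset.mul_prod_erase _ (fun s => r (w s)) (Finset.mem_univ t), Function.update_self, others]
  ring

variable [DecidableEq ι] [Fintype W] {r : W → ℝ}

theorem iidLaw_mem_stdSimplex (hr : r ∈ stdSimplex ℝ W) :
    (iidLaw r : (ι → W) → ℝ) ∈ stdSimplex ℝ (ι → W) := by
  refine ⟨fun w => Finset.prod_nonneg fun t _ => hr.1 _, ?_⟩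
  simp only [iidLaw]
  rw [← Fintype.prod_sum fun _ => r, Finset.prod_eq_one fun _ _ => hr.2]

theorem sum_iidLaw_mul_eq_sum_update (hr : ∑ u, r u = 1) (t : ι) (F : (ι → W) → ℝ) :
    ∑ w, iidLaw r w * F w = ∑ w, iidLaw r w * ∑ u, r u * F (Function.update w t u) := by
  -- Exchanging coordinate `t` with an independent copy is an involution preserving the law.
  have swap : Function.Involutive
      fun x : (ι → W) × W => (Function.update x.1 t x.2, x.1 t) := fun x => by ext <;> simp
  calc ∑ w, iidLaw r w * F w = ∑ x : (ι → W) × W, r x.2 * iidLaw r x.1 * F x.1 := by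
        rw [Fintype.sum_prod_type]
        simp only [← Finset.sum_mul, hr, one_mul]
    _ = ∑ x : (ι → W) × W, iidLaw r x.1 * (r x.2 * F (Function.update x.1 t x.2)) := by
        refine Fintype.sum_equiv swap.toPerm _ _ fun x => ?_
        simp only [Function.Involutive.coe_toPerm, Function.update_idem, Function.update_eq_self]
        rw [← mul_assoc, mul_comm _ (r (x.1 t)), iidLaw_mul_update]
    _ = ∑ w, iidLaw r w * ∑ u, r u * F (Function.update w t u) := by
        simp only [Fintype.sum_prod_type, Finset.mul_sum]

theorem sum_iidLaw_mul_mul_eval (hr : ∑ u, r u = 1) (t : ι) {f : (ι → W) → ℝ}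
    (hf : ∀ w u, f (Function.update w t u) = f w) (g : W → ℝ) :
    ∑ w, iidLaw r w * (f w * g (w t)) = (∑ w, iidLaw r w * f w) * ∑ u, r u * g u := by
  rw [sum_iidLaw_mul_eq_sum_update hr t, Finset.sum_mul]
  simp only [hf, Function.update_self, Finset.mul_sum]
  exact Finset.sum_congr rfl fun w _ => Finset.sum_congr rfl fun u _ => by ring

end IidLaw

section Learners

variable {ι α V W : Type*} [Preorder ι]

/-- A deterministic learner, given as the map that sends a table of feedbacks (`ℓ t i` is the
feedback of action `i` in round `t`) to the sequence of the actions played, is nonanticipating if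
each action depends only on the feedbacks observed in the earlier rounds. -/
def IsNonanticipating (I : (ι → α → V) → ι → α) : Prop :=
  ∀ ⦃ℓ ℓ'⦄ ⦃t⦄, (∀ s < t, ℓ s (I ℓ s) = ℓ' s (I ℓ s)) → I ℓ t = I ℓ' t

/-- The feedbacks observed by the learner `I` in the environment `ℓ`. -/
def observed (I : (ι → α → V) → ι → α) (ℓ : ι → α → V) (t : ι) : V := ℓ t (I ℓ t)

namespace IsNonanticipating

variable {I : (ι → α → V) → ι → α}

theorem comp {E : Type*} {I : (ι → α → E) → ι → α} (hI : IsNonanticipating I) (x : V → E) :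
    IsNonanticipating fun ℓ : ι → α → V => I fun t i => x (ℓ t i) :=
  fun _ _ _ h => hI fun s hs => congrArg x (h s hs)

theorem action_observed (hI : IsNonanticipating I) (ℓ : ι → α → V) :
    (I fun t _ => observed I ℓ t) = I ℓ := by
  funext t
  exact (@hI ℓ (fun s _ => observed I ℓ s) t fun s _ => rfl).symm

theorem observed_eq_iff (hI : IsNonanticipating I) {ℓ : ι → α → V} {z : ι → V} :
    observed I ℓ = z ↔ ∀ t, ℓ t (I (fun s _ => z s) t) = z t := by
  constructor
  · rintro rfl t
    rw [hI.action_observed, observed]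
  · intro h
    have same_actions : (I fun s _ => z s) = I ℓ := funext fun t => hI fun s _ => (h s).symm
    exact funext fun t => by rw [observed, ← same_actions, h t]

theorem action_update [DecidableEq ι] (hI : IsNonanticipating I) (Λ : W → α → V) (w : ι → W)
    (t : ι) (u : W) : I (fun s => Λ (Function.update w t u s)) t = I (fun s => Λ (w s)) t :=
  hI fun s hs => by rw [Function.update_of_ne hs.ne]

end IsNonanticipating

end Learners

section Pulls

variable {ι α V W : Type*} [Fintype ι] [DecidableEq α]

/-- The number of rounds in which the action `i` is played. -/
def pullCount (a : ι → α) (i : α) : ℕ := Finset.card {t | a t = i}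

variable [DecidableEq ι] [Fintype W]

/-- The mean number of plays of action `i` by the learner `I` when the environment of round `t` is
`Λ (w t)` for independent noises `w t` of law `r`. -/
def meanPulls (I : (ι → α → V) → ι → α) (r : W → ℝ) (Λ : W → α → V) (i : α) : ℝ :=
  ∑ w : ι → W, iidLaw r w * pullCount (I fun t => Λ (w t)) i

theorem meanPulls_eq_sum (I : (ι → α → V) → ι → α) (r : W → ℝ) (Λ : W → α → V) (i : α) :
    meanPulls I r Λ i =
      ∑ t, ∑ w : ι → W, iidLaw r w * if I (fun s => Λ (w s)) t = i then 1 else 0 := by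
  simp only [meanPulls, pullCount, Finset.natCast_card_filter, Finset.mul_sum]
  exact Finset.sum_comm

variable [Preorder ι] [Fintype α] {I : (ι → α → V) → ι → α} {r : W → ℝ}

/-- Wald's identity: the noise of a round is independent of the action played in that round. -/
theorem sum_iidLaw_mul_sum_action (hI : IsNonanticipating I) (hr : ∑ u, r u = 1)
    (Λ : W → α → V) (G : α → W → ℝ) :
    ∑ w : ι → W, iidLaw r w * ∑ t, G (I (fun s => Λ (w s)) t) (w t) =
      ∑ i, meanPulls I r Λ i * ∑ u, r u * G i u := by
  have round (t : ι) (i : α) : ∑ w : ι → W, iidLaw r w *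
        ((if I (fun s => Λ (w s)) t = i then 1 else 0) * G i (w t)) =
      (∑ w : ι → W, iidLaw r w * if I (fun s => Λ (w s)) t = i then 1 else 0) *
        ∑ u, r u * G i u :=
    sum_iidLaw_mul_mul_eval hr t (fun w u => by simp only [hI.action_update]) (G i)
  calc ∑ w : ι → W, iidLaw r w * ∑ t, G (I (fun s => Λ (w s)) t) (w t)
      = ∑ t, ∑ i, ∑ w : ι → W, iidLaw r w *
          ((if I (fun s => Λ (w s)) t = i then 1 else 0) * G i (w t)) := by
        simp only [Finset.mul_sum]
        rw [Finset.sum_comm]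
        refine Finset.sum_congr rfl fun t _ => ?_
        rw [Finset.sum_comm]
        simp
    _ = ∑ i, meanPulls I r Λ i * ∑ u, r u * G i u := by
        simp only [round, meanPulls_eq_sum]
        rw [Finset.sum_comm]
        exact Finset.sum_congr rfl fun i _ => (Finset.sum_mul _ _ _).symm

theorem sum_meanPulls (hI : IsNonanticipating I) (hr : r ∈ stdSimplex ℝ W) (Λ : W → α → V) :
    ∑ i, meanPulls I r Λ i = Fintype.card ι := by
  have h := sum_iidLaw_mul_sum_action hI hr.2 Λ fun _ _ => 1
  simp only [mul_one, hr.2, Finset.sum_const, Finset.card_univ, nsmul_eq_mul,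
    ← Finset.sum_mul, (iidLaw_mem_stdSimplex hr).2, one_mul] at h
  exact h.symm

end Pulls

section Transcripts

variable {ι α V W : Type*} [Fintype ι] [Fintype V] [Fintype W]
  {I : (ι → α → V) → ι → α} {r : W → ℝ} {Λ Λ' : W → α → V}

/-- The law of the feedbacks observed by the learner `I` when the environment of round `t` is
`Λ (w t)` for independent noises `w t` of law `r`. -/
noncomputable def transcriptLaw (I : (ι → α → V) → ι → α) (r : W → ℝ) (Λ : W → α → V) :
    (ι → V) → ℝ :=
  FunOnFinite.map (fun w : ι → W => observed I fun t => Λ (w t)) (iidLaw r)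

theorem sum_transcriptLaw [DecidableEq ι] (I : (ι → α → V) → ι → α) (hr : r ∈ stdSimplex ℝ W)
    (Λ : W → α → V) : ∑ z, transcriptLaw I r Λ z = 1 :=
  (sum_map _ _).trans (iidLaw_mem_stdSimplex hr).2

variable [Preorder ι]

theorem transcriptLaw_apply (hI : IsNonanticipating I) (r : W → ℝ) (Λ : W → α → V) (z : ι → V) :
    transcriptLaw I r Λ z =
      ∏ t, FunOnFinite.map (fun u => Λ u (I (fun s _ => z s) t)) r (z t) := by
  classical
  simp only [transcriptLaw, FunOnFinite.map_apply_apply, iidLaw, hI.observed_eq_iff,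
    Finset.prod_univ_sum]
  exact Finset.sum_congr (by ext w; simp) fun _ _ => rfl

theorem transcriptLaw_pos (hI : IsNonanticipating I)
    (hΛ : ∀ i v, 0 < FunOnFinite.map (fun u => Λ u i) r v) (z : ι → V) :
    0 < transcriptLaw I r Λ z := by
  rw [transcriptLaw_apply hI]
  exact Finset.prod_pos fun t _ => hΛ _ _

variable [DecidableEq ι] [DecidableEq α]

theorem meanPulls_eq_sum_transcriptLaw (hI : IsNonanticipating I) (r : W → ℝ) (Λ : W → α → V)
    (i : α) : meanPulls I r Λ i =
      ∑ z, transcriptLaw I r Λ z * pullCount (I fun t _ => z t) i := by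
  rw [transcriptLaw, sum_map_mul]
  simp only [hI.action_observed, meanPulls]

theorem relEntropy_transcriptLaw [Fintype α] (hI : IsNonanticipating I) (hr : ∑ u, r u = 1)
    (hΛ : ∀ i v, 0 < FunOnFinite.map (fun u => Λ u i) r v)
    (hΛ' : ∀ i v, 0 < FunOnFinite.map (fun u => Λ' u i) r v) :
    relEntropy (transcriptLaw I r Λ) (transcriptLaw I r Λ') =
      ∑ i, meanPulls I r Λ i *
        relEntropy (FunOnFinite.map (fun u => Λ u i) r) (FunOnFinite.map (fun u => Λ' u i) r) := by
  let logRatio (i : α) (v : V) : ℝ :=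
    Real.log (FunOnFinite.map (fun u => Λ u i) r v / FunOnFinite.map (fun u => Λ' u i) r v)
  have chain_rule (z : ι → V) : Real.log (transcriptLaw I r Λ z / transcriptLaw I r Λ' z) =
      ∑ t, logRatio (I (fun s _ => z s) t) (z t) := by
    rw [transcriptLaw_apply hI, transcriptLaw_apply hI, ← Finset.prod_div_distrib,
      Real.log_prod fun t _ => (div_pos (hΛ _ _) (hΛ' _ _)).ne']
  calc relEntropy (transcriptLaw I r Λ) (transcriptLaw I r Λ')
      = ∑ z, transcriptLaw I r Λ z * ∑ t, logRatio (I (fun s _ => z s) t) (z t) := by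
        simp only [relEntropy, chain_rule]
    _ = ∑ w : ι → W, iidLaw r w *
          ∑ t, logRatio (I (fun s => Λ (w s)) t) (Λ (w t) (I (fun s => Λ (w s)) t)) := by
        rw [transcriptLaw, sum_map_mul]
        simp only [hI.action_observed]
        rfl
    _ = ∑ i, meanPulls I r Λ i * ∑ u, r u * logRatio i (Λ u i) :=
        sum_iidLaw_mul_sum_action hI hr Λ fun i u => logRatio i (Λ u i)
    _ = ∑ i, meanPulls I r Λ i * relEntropy (FunOnFinite.map (fun u => Λ u i) r)
          (FunOnFinite.map (fun u => Λ' u i) r) := by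
        simp only [relEntropy, sum_map_mul, logRatio]

theorem meanPulls_le_add_relEntropy (hI : IsNonanticipating I) (hr : r ∈ stdSimplex ℝ W)
    (hΛ : ∀ i v, 0 < FunOnFinite.map (fun u => Λ u i) r v)
    (hΛ' : ∀ i v, 0 < FunOnFinite.map (fun u => Λ' u i) r v) {c : ℝ} (hc : 0 < c) (i : α) :
    meanPulls I r Λ' i ≤ meanPulls I r Λ i + Fintype.card ι *
      (c / 2 + relEntropy (transcriptLaw I r Λ) (transcriptLaw I r Λ') / c) := by
  rw [meanPulls_eq_sum_transcriptLaw hI, meanPulls_eq_sum_transcriptLaw hI]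
  exact sum_mul_le_sum_mul_add_relEntropy (transcriptLaw_pos hI hΛ) (transcriptLaw_pos hI hΛ')
    (sum_transcriptLaw I hr Λ) (sum_transcriptLaw I hr Λ')
    (fun z => ⟨Nat.cast_nonneg _, Nat.cast_le.2 (Finset.card_le_univ _)⟩) hc

end Transcripts

section PlantedAction

variable {ι α V W : Type*}

/-- The random environment in which action `j` yields the feedback `Y u` of the noise `u`, while
all other actions yield the feedback `X u`. -/
def plantAction [DecidableEq α] (X Y : W → V) (j : α) (u : W) : α → V :=
  Function.update (fun _ => X u) j (Y u)

variable [Fintype ι] [DecidableEq ι] [Preorder ι] [DecidableEq α] [Fintype W]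
  {I : (ι → α → V) → ι → α} {r : W → ℝ} {X Y : W → V}

theorem sum_iidLaw_mul_excess_plantAction [Finite α] (hI : IsNonanticipating I)
    (hr : r ∈ stdSimplex ℝ W) (X Y : W → V) (x : V → ℝ) (j : α) :
    ∑ w : ι → W, iidLaw r w * ∑ t,
        (x (plantAction X Y j (w t) (I (fun s => plantAction X Y j (w s)) t)) -
          x (plantAction X Y j (w t) j)) =
      (∑ u, r u * (x (X u) - x (Y u))) *
        (Fintype.card ι - meanPulls I r (plantAction X Y j) j) := by
  cases nonempty_fintype α
  have excess (i : α) :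
      ∑ u, r u * (x (plantAction X Y j u i) - x (plantAction X Y j u j)) =
        (∑ u, r u * (x (X u) - x (Y u))) * if i = j then 0 else 1 := by
    rcases eq_or_ne i j with rfl | hi <;> simp [plantAction, *]
  have others : ∑ i, meanPulls I r (plantAction X Y j) i * (if i = j then 0 else 1) =
      Fintype.card ι - meanPulls I r (plantAction X Y j) j := by
    rw [← sum_meanPulls hI hr (plantAction X Y j), eq_sub_iff_add_eq,
      ← Fintype.sum_ite_eq' j (meanPulls I r (plantAction X Y j)), ← Finset.sum_add_distrib]
    exact Finset.sum_congr rfl fun i _ => by split_ifs <;> simp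
  rw [sum_iidLaw_mul_sum_action hI hr.2 (plantAction X Y j) fun i u =>
    x (plantAction X Y j u i) - x (plantAction X Y j u j), ← others, Finset.mul_sum]
  exact Finset.sum_congr rfl fun i _ => by rw [excess]; ring

variable [Fintype V]

theorem meanPulls_plantAction_le [Finite α] (hI : IsNonanticipating I) (hr : r ∈ stdSimplex ℝ W)
    (hX : ∀ v, 0 < FunOnFinite.map X r v) (hY : ∀ v, 0 < FunOnFinite.map Y r v)
    {c : ℝ} (hc : 0 < c) (j : α) :
    meanPulls I r (plantAction X Y j) j ≤ meanPulls I r (fun u _ => X u) j +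
      Fintype.card ι * (c / 2 + meanPulls I r (fun u _ => X u) j *
        relEntropy (FunOnFinite.map X r) (FunOnFinite.map Y r) / c) := by
  cases nonempty_fintype α
  have marginal_self : (fun u => plantAction X Y j u j) = Y := by ext u; simp [plantAction]
  have marginal_ne {i : α} (hi : i ≠ j) : (fun u => plantAction X Y j u i) = X := by
    ext u; simp [plantAction, hi]
  have planted_pos : ∀ i v, 0 < FunOnFinite.map (fun u => plantAction X Y j u i) r v := by
    intro i
    rcases eq_or_ne i j with rfl | hi
    · rwa [marginal_self]
    · rwa [marginal_ne hi]
  have h := meanPulls_le_add_relEntropy hI hr (Λ := fun u _ => X u) (fun _ => hX) planted_pos hc j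
  rwa [relEntropy_transcriptLaw hI hr.2 (fun _ => hX) planted_pos,
    Finset.sum_eq_single j (fun i _ hi => by rw [marginal_ne hi, relEntropy_self, mul_zero])
      (by simp), marginal_self] at h

/-- Summing over `j` makes up for not knowing the action that the learner neglects: the actions
played against the unplanted environment share the `card ι` rounds among them. -/
theorem le_sum_excess_plantAction [Fintype α] (hI : IsNonanticipating I) (hr : r ∈ stdSimplex ℝ W)
    (hX : ∀ v, 0 < FunOnFinite.map X r v) (hY : ∀ v, 0 < FunOnFinite.map Y r v) {x : V → ℝ}
    (hx : 0 ≤ ∑ u, r u * (x (X u) - x (Y u))) {c : ℝ} (hc : 0 < c) :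
    (∑ u, r u * (x (X u) - x (Y u))) * (Fintype.card ι * (Fintype.card α - 1 -
      (Fintype.card α * c / 2 + Fintype.card ι *
        relEntropy (FunOnFinite.map X r) (FunOnFinite.map Y r) / c))) ≤
      ∑ j, ∑ w : ι → W, iidLaw r w * ∑ t,
        (x (plantAction X Y j (w t) (I (fun s => plantAction X Y j (w s)) t)) -
          x (plantAction X Y j (w t) j)) := by
  simp only [sum_iidLaw_mul_excess_plantAction hI hr X Y x, ← Finset.mul_sum]
  refine mul_le_mul_of_nonneg_left ?_ hx
  set κ := relEntropy (FunOnFinite.map X r) (FunOnFinite.map Y r)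
  have planted_pulls : ∑ j, meanPulls I r (plantAction X Y j) j ≤ Fintype.card ι +
      Fintype.card ι * (Fintype.card α * c / 2 + Fintype.card ι * κ / c) :=
    calc ∑ j, meanPulls I r (plantAction X Y j) j
        ≤ ∑ j, (meanPulls I r (fun u _ => X u) j + Fintype.card ι *
            (c / 2 + meanPulls I r (fun u _ => X u) j * κ / c)) :=
          Finset.sum_le_sum fun j _ => meanPulls_plantAction_le hI hr hX hY hc j
      _ = Fintype.card ι + Fintype.card ι * (Fintype.card α * c / 2 + Fintype.card ι * κ / c) := by
          simp only [Finset.sum_add_distrib, ← Finset.mul_sum, ← Finset.sum_div, ← Finset.sum_mul,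
            sum_meanPulls hI hr, Finset.sum_const, Finset.card_univ, nsmul_eq_mul]
  rw [Finset.sum_sub_distrib, Finset.sum_const, Finset.card_univ, nsmul_eq_mul]
  linarith

end PlantedAction

namespace BanditAlgorithm

variable {K T : ℕ} {Ω : Type*} [MeasurableSpace Ω] (A : BanditAlgorithm K T Ω)

theorem isNonanticipating_action (ω : Ω) : IsNonanticipating fun ℓ => A.action ℓ ω := by
  rintro ℓ ℓ' ⟨n, hn⟩
  induction n using Nat.strong_induction_on with
  | _ n ih =>
    intro same_losses
    have same_past (s : Fin n) :
        A.action ℓ ω ⟨s, s.isLt.trans hn⟩ = A.action ℓ' ω ⟨s, s.isLt.trans hn⟩ :=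
      ih s s.isLt _ fun r hr => same_losses r (hr.trans (Fin.mk_lt_mk.2 s.isLt))
    beta_reduce at same_losses ⊢
    rw [action, action]
    congr 1
    funext s
    rw [← same_past s, same_losses ⟨s, s.isLt.trans hn⟩ (Fin.mk_lt_mk.2 s.isLt)]

theorem measurable_action (ℓ : Fin T → Fin K → ℝ) : Measurable (A.action ℓ) := by
  refine measurable_pi_lambda _ fun ⟨n, hn⟩ => ?_
  induction n using Nat.strong_induction_on with
  | _ n ih =>
    conv => enter [1, ω]; rw [action]
    refine (A.measurable_act ⟨n, hn⟩).comp (measurable_id.prodMk (measurable_pi_lambda _ ?_))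
    intro s
    have past := ih s s.isLt (s.isLt.trans hn)
    exact past.prodMk ((measurable_of_finite _).comp past)

variable (P : Measure Ω) [IsProbabilityMeasure P]

theorem integrable_regret (ℓ : Fin T → Fin K → ℝ) : Integrable (A.regret ℓ) P := by
  have : IsProbabilityMeasure (P.map (A.action ℓ)) :=
    Measure.isProbabilityMeasure_map (A.measurable_action ℓ).aemeasurable
  exact (Integrable.of_finite (μ := P.map (A.action ℓ))
    (f := fun a => ∑ t, ℓ t (a t) - ⨅ i, ∑ t, ℓ t i)).comp_measurable (A.measurable_action ℓ)

theorem expectedRegret_le {ℓ : Fin T → Fin K → ℝ} (hℓ : ∀ t i, ℓ t i ∈ Set.Icc (0 : ℝ) 1) :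
    A.expectedRegret P ℓ ≤ T := by
  have regret_le (ω : Ω) : A.regret ℓ ω ≤ T :=
    calc A.regret ℓ ω ≤ ∑ t, ℓ t (A.action ℓ ω t) :=
          sub_le_self _ (Real.iInf_nonneg fun i => Finset.sum_nonneg fun t _ => (hℓ t i).1)
      _ ≤ ∑ _t : Fin T, (1 : ℝ) := Finset.sum_le_sum fun t _ => (hℓ t _).2
      _ = T := by simp
  calc A.expectedRegret P ℓ ≤ ∫ _ω, (T : ℝ) ∂P :=
        integral_mono (A.integrable_regret P ℓ) (integrable_const _) regret_le
    _ = T := by simp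

theorem bddAbove_expectedRegret (ρ : ℝ) :
    BddAbove (Set.range fun ℓ : {ℓ : Fin T → Fin K → ℝ // ∀ t, ℓ t ∈ lossesOfRange K ρ} =>
      A.expectedRegret P ℓ.1) :=
  ⟨T, by rintro _ ⟨ℓ, rfl⟩; exact A.expectedRegret_le P fun t => (ℓ.2 t).1⟩

theorem sum_sub_le_regret (ℓ : Fin T → Fin K → ℝ) (ω : Ω) (j : Fin K) :
    ∑ t, (ℓ t (A.action ℓ ω t) - ℓ t j) ≤ A.regret ℓ ω := by
  rw [Finset.sum_sub_distrib]
  exact sub_le_sub_left (ciInf_le (Set.finite_range fun i => ∑ t, ℓ t i).bddBelow j) _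

theorem exists_le_expectedRegret {S : Type*} [Fintype S] {m : S → ℝ} (hm : m ∈ stdSimplex ℝ S)
    (ℓ : S → Fin T → Fin K → ℝ) {c : ℝ} (hc : ∀ ω, c ≤ ∑ s, m s * A.regret (ℓ s) ω) :
    ∃ s, c ≤ A.expectedRegret P (ℓ s) := by
  refine exists_le_of_le_sum_mul hm ?_
  have integrable (s : S) : Integrable (fun ω => m s * A.regret (ℓ s) ω) P :=
    (A.integrable_regret P (ℓ s)).const_mul _
  calc c = ∫ _ω, c ∂P := by simp
    _ ≤ ∫ ω, ∑ s, m s * A.regret (ℓ s) ω ∂P :=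
        integral_mono (integrable_const _) (integrable_finsetSum _ fun s _ => integrable s) hc
    _ = ∑ s, m s * A.expectedRegret P (ℓ s) := by
        rw [integral_finsetSum _ fun s _ => integrable s]
        simp only [integral_const_mul, expectedRegret]

theorem exists_plantAction_le_expectedRegret {V W : Type*} [Fintype V] [Fintype W] {r : W → ℝ}
    {X Y : W → V} (hK : 0 < K) (hr : r ∈ stdSimplex ℝ W)
    (hX : ∀ v, 0 < FunOnFinite.map X r v) (hY : ∀ v, 0 < FunOnFinite.map Y r v) {x : V → ℝ}
    (hx : 0 ≤ ∑ u, r u * (x (X u) - x (Y u))) {c : ℝ} (hc : 0 < c) :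
    ∃ (j : Fin K) (w : Fin T → W), (∑ u, r u * (x (X u) - x (Y u))) *
        (T / K * (K - 1 - (K * c / 2 +
          T * relEntropy (FunOnFinite.map X r) (FunOnFinite.map Y r) / c))) ≤
      A.expectedRegret P fun t i => x (plantAction X Y j (w t) i) := by
  let m : Fin K × (Fin T → W) → ℝ := fun s => 1 / K * iidLaw r s.2
  have hm : m ∈ stdSimplex ℝ (Fin K × (Fin T → W)) := by
    refine ⟨fun s => mul_nonneg (by positivity) ((iidLaw_mem_stdSimplex hr).1 _), ?_⟩
    have : (K : ℝ) ≠ 0 := by positivity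
    simp [m, Fintype.sum_prod_type, ← Finset.mul_sum, (iidLaw_mem_stdSimplex hr).2, this]
  set δ := ∑ u, r u * (x (X u) - x (Y u))
  set κ := relEntropy (FunOnFinite.map X r) (FunOnFinite.map Y r)
  have average_regret (ω : Ω) : δ * (T / K * (K - 1 - (K * c / 2 + T * κ / c))) ≤
      ∑ s, m s * A.regret (fun t i => x (plantAction X Y s.1 (s.2 t) i)) ω := by
    have excess :=
      le_sum_excess_plantAction ((A.isNonanticipating_action ω).comp x) hr hX hY hx hc
    rw [Fintype.card_fin, Fintype.card_fin] at excess
    calc δ * (T / K * (K - 1 - (K * c / 2 + T * κ / c)))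
        = 1 / K * (δ * (T * (K - 1 - (K * c / 2 + T * κ / c)))) := by ring
      _ ≤ 1 / K * ∑ j, ∑ w, iidLaw r w *
            A.regret (fun t i => x (plantAction X Y j (w t) i)) ω := by
          refine mul_le_mul_of_nonneg_left (excess.trans ?_) (by positivity)
          gcongr with j _ w _
          · exact (iidLaw_mem_stdSimplex hr).1 w
          · exact A.sum_sub_le_regret (fun t i => x (plantAction X Y j (w t) i)) ω j
      _ = ∑ s, m s * A.regret (fun t i => x (plantAction X Y s.1 (s.2 t) i)) ω := by
          simp only [m, Fintype.sum_prod_type, Finset.mul_sum, mul_assoc]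
  obtain ⟨s, hs⟩ := A.exists_le_expectedRegret P hm _ average_regret
  exact ⟨s.1, s.2, hs⟩

end BanditAlgorithm

section GridWalk

/-- The joint law of a uniform grid point `k : Fin N` and of the event that the planted arm is moved
one grid point down. That event has conditional probability `k (N - k) / N ^ 2`: it vanishes at the
ends of the grid, so that the law of the moved point stays within a factor `1 ± 1 / N` of the
uniform law. -/
noncomputable def stepLaw (N : ℕ) (u : Fin N × Bool) : ℝ :=
  (if u.2 then (u.1 : ℝ) * (N - u.1) / N ^ 2 else 1 - (u.1 : ℝ) * (N - u.1) / N ^ 2) / N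

/-- The grid point after the possible step down. -/
def steppedPoint {N : ℕ} (u : Fin N × Bool) : Fin N :=
  ⟨u.1 - u.2.toNat, (Nat.sub_le _ _).trans_lt u.1.isLt⟩

/-- The linear tilt `1 + (N - 1 - 2 v) / N ^ 2` of the uniform law on the grid `Fin N`; it is the
law of `steppedPoint` under `stepLaw`. -/
noncomputable def tiltedLaw (N : ℕ) (v : Fin N) : ℝ := (1 + ((N : ℝ) - 1 - 2 * v) / N ^ 2) / N

variable {N : ℕ}

theorem map_fst_stepLaw (N : ℕ) : FunOnFinite.map Prod.fst (stepLaw N) = fun _ => 1 / (N : ℝ) := by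
  funext v
  rw [FunOnFinite.map_apply_apply, Finset.sum_filter, Fintype.sum_prod_type,
    Finset.sum_eq_single v (fun k _ hk => by simp [hk]) (by simp)]
  simp only [Fintype.sum_bool, stepLaw, if_true, Bool.false_eq_true, if_false]
  ring

theorem map_steppedPoint_stepLaw (N : ℕ) :
    FunOnFinite.map steppedPoint (stepLaw N) = tiltedLaw N := by
  funext v
  have hN : (N : ℝ) ≠ 0 := Nat.cast_ne_zero.2 (Nat.ne_zero_of_lt v.isLt)
  let down (k : ℕ) : ℝ := (k : ℝ) * (N - k) / N ^ 2 / N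
  -- The weight `down` vanishes at `0`, where no step is possible, and at `N`, beyond the grid.
  have from_above : (∑ k : Fin N, if (k : ℕ) - 1 = v then down k else 0) = down (v + 1) := by
    have shift := Finset.sum_range_succ' (fun k => if k - 1 = (v : ℕ) then down k else 0) N
    rw [Finset.sum_range_succ] at shift
    have down_zero : down 0 = 0 := by simp [down]
    have down_top : down N = 0 := by simp [down]
    simp only [down_zero, down_top, ite_self, add_zero, Nat.add_sub_cancel,
      Finset.sum_ite_eq', Finset.mem_range, v.isLt, if_true] at shift
    rw [Fin.sum_univ_eq_sum_range (fun k => if k - 1 = (v : ℕ) then down k else 0) N, shift]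
  have unmoved : (∑ k : Fin N, if k = v then (1 - (k : ℝ) * (N - k) / N ^ 2) / N else 0) =
      1 / N - down v := by
    simp only [Finset.sum_ite_eq', Finset.mem_univ, if_true, down]
    ring
  rw [FunOnFinite.map_apply_apply, Finset.sum_filter, Fintype.sum_prod_type]
  simp only [Fintype.sum_bool, steppedPoint, Fin.ext_iff, Bool.toNat_true, Bool.toNat_false,
    Nat.sub_zero, stepLaw, if_true, Bool.false_eq_true, if_false, Finset.sum_add_distrib]
  simp only [← Fin.ext_iff, unmoved]
  rw [from_above]
  simp only [down, tiltedLaw]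
  push_cast
  field_simp
  ring

theorem stepLaw_mem_stdSimplex (hN : 0 < N) : stepLaw N ∈ stdSimplex ℝ (Fin N × Bool) := by
  constructor
  · intro u
    have hk : (u.1 : ℝ) ≤ N := by exact_mod_cast u.1.isLt.le
    have hk0 : (0 : ℝ) ≤ u.1 := Nat.cast_nonneg _
    unfold stepLaw
    refine div_nonneg ?_ (Nat.cast_nonneg _)
    split_ifs
    · exact div_nonneg (mul_nonneg hk0 (by linarith)) (by positivity)
    · exact sub_nonneg.2 (div_le_one_of_le₀ (by nlinarith) (by positivity))
  · have : (N : ℝ) ≠ 0 := by positivity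
    rw [← sum_map Prod.fst, map_fst_stepLaw]
    simp [this]

theorem sum_range_mul_sub (a : ℝ) (n : ℕ) : ∑ k ∈ Finset.range n, (k : ℝ) * (a - k) =
    a * n * (n - 1) / 2 - (n - 1) * n * (2 * n - 1) / 6 := by
  induction n with
  | zero => simp
  | succ n ih =>
    rw [Finset.sum_range_succ, ih]
    push_cast
    ring

theorem sum_stepLaw_mul_sub (hN : 0 < N) :
    ∑ u, stepLaw N u * ((u.1 : ℝ) / N - (steppedPoint u : ℝ) / N) =
      ((N : ℝ) ^ 2 - 1) / (6 * N ^ 3) := by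
  have hN0 : (N : ℝ) ≠ 0 := by positivity
  have step (k : Fin N) : ∑ b, stepLaw N (k, b) * ((k : ℝ) / N - (steppedPoint (k, b) : ℝ) / N) =
      (k : ℝ) * (N - k) / N ^ 4 := by
    simp only [Fintype.sum_bool, stepLaw, steppedPoint, Bool.toNat_true, Bool.toNat_false,
      if_true, Bool.false_eq_true, if_false, Nat.sub_zero, sub_self, mul_zero, add_zero]
    rcases Nat.eq_zero_or_pos (k : ℕ) with hk | hk
    · simp [hk]
    · rw [Nat.cast_pred hk]
      field_simp
      ring
  rw [Fintype.sum_prod_type]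
  simp only [step]
  rw [← Finset.sum_div, Fin.sum_univ_eq_sum_range (fun k => (k : ℝ) * (N - k)) N,
    sum_range_mul_sub]
  field_simp
  ring

theorem abs_tilt_le (v : Fin N) : |((N : ℝ) - 1 - 2 * v) / N ^ 2| ≤ 1 / (N : ℝ) := by
  have hN : (0 : ℝ) < N := Nat.cast_pos.2 (Nat.zero_lt_of_lt v.isLt)
  have hv : (v : ℝ) + 1 ≤ N := by exact_mod_cast v.isLt
  have : (0 : ℝ) ≤ v := Nat.cast_nonneg _
  rw [abs_div, abs_of_pos (pow_pos hN 2)]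
  calc |(N : ℝ) - 1 - 2 * v| / (N : ℝ) ^ 2 ≤ N / (N : ℝ) ^ 2 := by
        gcongr
        exact abs_le.2 ⟨by linarith, by linarith⟩
    _ = 1 / (N : ℝ) := by field_simp

theorem le_tiltedLaw (hN : 5 ≤ N) (v : Fin N) : 4 / (5 * (N : ℝ)) ≤ tiltedLaw N v := by
  have hN5 : (5 : ℝ) ≤ N := by exact_mod_cast hN
  have small_tilt : 1 / (N : ℝ) ≤ 1 / 5 := one_div_le_one_div_of_le (by norm_num) hN5
  have := (abs_le.1 (abs_tilt_le v)).1
  rw [tiltedLaw, ← div_div]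
  gcongr
  linarith

theorem tiltedLaw_pos (hN : 5 ≤ N) (v : Fin N) : 0 < tiltedLaw N v := by
  have : 0 < N := by omega
  exact lt_of_lt_of_le (by positivity) (le_tiltedLaw hN v)

theorem relEntropy_uniform_tiltedLaw_le (hN : 5 ≤ N) :
    relEntropy (fun _ => 1 / (N : ℝ)) (tiltedLaw N) ≤ 5 / 4 / (N : ℝ) ^ 2 := by
  have : N ≠ 0 := by omega
  have same_mass : ∑ _v : Fin N, 1 / (N : ℝ) = ∑ v, tiltedLaw N v := by
    rw [← map_fst_stepLaw, ← map_steppedPoint_stepLaw, sum_map, sum_map]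
  have pointwise (v : Fin N) :
      (1 / (N : ℝ) - tiltedLaw N v) ^ 2 / tiltedLaw N v ≤ 5 / 4 / (N : ℝ) ^ 3 :=
    calc (1 / (N : ℝ) - tiltedLaw N v) ^ 2 / tiltedLaw N v
        ≤ (1 / (N : ℝ) / N) ^ 2 / (4 / (5 * (N : ℝ))) := by
          have : 1 / (N : ℝ) - tiltedLaw N v = -(((N : ℝ) - 1 - 2 * v) / N ^ 2 / N) := by
            rw [tiltedLaw]
            ring
          rw [this, neg_sq, ← sq_abs, abs_div, Nat.abs_cast]
          gcongr
          · exact abs_tilt_le v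
          · exact le_tiltedLaw hN v
      _ = 5 / 4 / (N : ℝ) ^ 3 := by field_simp
  calc relEntropy (fun _ => 1 / (N : ℝ)) (tiltedLaw N)
      ≤ ∑ v : Fin N, (1 / (N : ℝ) - tiltedLaw N v) ^ 2 / tiltedLaw N v :=
        relEntropy_le_chiSq (fun _ => by positivity) (tiltedLaw_pos hN) same_mass
    _ ≤ ∑ _v : Fin N, 5 / 4 / (N : ℝ) ^ 3 := Finset.sum_le_sum fun v _ => pointwise v
    _ = 5 / 4 / (N : ℝ) ^ 2 := by
        simp only [Finset.sum_const, Finset.card_univ, Fintype.card_fin, nsmul_eq_mul]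
        field_simp

theorem abs_sub_steppedPoint_le (u : Fin N × Bool) :
    |(u.1 : ℝ) / N - (steppedPoint u : ℝ) / N| ≤ 1 / (N : ℝ) := by
  have hle : (steppedPoint u : ℕ) ≤ u.1 := Nat.sub_le _ _
  have hlt : (u.1 : ℕ) ≤ steppedPoint u + 1 := by
    have := Bool.toNat_le u.2
    simp only [steppedPoint]
    omega
  have hle' : (steppedPoint u : ℝ) ≤ u.1 := by exact_mod_cast hle
  have hlt' : (u.1 : ℝ) ≤ steppedPoint u + 1 := by exact_mod_cast hlt
  rw [← sub_div, abs_div, Nat.abs_cast]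
  gcongr
  exact abs_le.2 ⟨by linarith, by linarith⟩

theorem plantAction_mem_lossesOfRange {K : ℕ} {ρ : ℝ} (hρ : 1 / (N : ℝ) ≤ ρ) (j : Fin K)
    (u : Fin N × Bool) :
    (fun i => ((plantAction Prod.fst steppedPoint j u i : Fin N) : ℝ) / N) ∈ lossesOfRange K ρ := by
  have hρ0 : 0 ≤ ρ := le_trans (by positivity) hρ
  have hstep := (abs_sub_steppedPoint_le u).trans hρ
  refine ⟨fun i => ⟨by positivity, div_le_one_of_le₀ ?_ (Nat.cast_nonneg _)⟩, fun i k => ?_⟩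
  · exact_mod_cast (Fin.is_lt _).le
  · simp only [plantAction, Function.update_apply]
    split_ifs
    · simpa using hρ0
    · rwa [abs_sub_comm]
    · exact hstep
    · simpa using hρ0

end GridWalk

theorem exists_lossesOfRange_le_expectedRegret {K T N : ℕ} {ρ : ℝ} (hK : 0 < K) (hN : 5 ≤ N)
    (hρ : 1 / (N : ℝ) ≤ ρ) {Ω : Type*} [MeasurableSpace Ω] (P : Measure Ω)
    [IsProbabilityMeasure P] (A : BanditAlgorithm K T Ω) :
    ∃ ℓ : Fin T → Fin K → ℝ, (∀ t, ℓ t ∈ lossesOfRange K ρ) ∧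
      ((N : ℝ) ^ 2 - 1) / (6 * N ^ 3) * (T / K * (K - 1 - (K / 8 + 5 * T / N ^ 2))) ≤
        A.expectedRegret P ℓ := by
  have hN0 : 0 < N := by omega
  have hgap := sum_stepLaw_mul_sub hN0
  have hgap0 : 0 ≤ ((N : ℝ) ^ 2 - 1) / (6 * N ^ 3) :=
    div_nonneg (sub_nonneg.2 (one_le_pow₀ (by exact_mod_cast hN0))) (by positivity)
  obtain ⟨j, w, h⟩ := A.exists_plantAction_le_expectedRegret P
    (X := Prod.fst) (Y := steppedPoint) (x := fun v : Fin N => (v : ℝ) / N) hK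
    (stepLaw_mem_stdSimplex hN0) (fun v => by rw [map_fst_stepLaw]; positivity)
    (fun v => by rw [map_steppedPoint_stepLaw]; exact tiltedLaw_pos hN v)
    (hgap.symm ▸ hgap0) (c := 1 / 4) (by norm_num)
  refine ⟨_, fun t => plantAction_mem_lossesOfRange hρ j (w t), le_trans ?_ h⟩
  rw [hgap, map_fst_stepLaw, map_steppedPoint_stepLaw]
  have hdiv : (T : ℝ) * relEntropy (fun _ => 1 / (N : ℝ)) (tiltedLaw N) / (1 / 4) ≤
      5 * T / N ^ 2 :=
    calc (T : ℝ) * relEntropy (fun _ => 1 / (N : ℝ)) (tiltedLaw N) / (1 / 4)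
        ≤ T * (5 / 4 / N ^ 2) / (1 / 4) := by
          gcongr
          exact relEntropy_uniform_tiltedLaw_le hN
      _ = 5 * T / N ^ 2 := by ring
  refine mul_le_mul_of_nonneg_left (mul_le_mul_of_nonneg_left ?_ (by positivity)) hgap0
  linarith

theorem exists_grid_size {σ : ℝ} (hσ : 0 < σ) (hσ1 : σ ≤ 1) :
    ∃ N : ℕ, 5 ≤ N ∧ 1 / (N : ℝ) ≤ 0.22 * σ ∧ N * σ ≤ 5.6 := by
  refine ⟨⌈1 / (0.22 * σ)⌉₊, ?_, ?_, ?_⟩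
  · refine Nat.succ_le_of_lt (Nat.lt_ceil.2 ?_)
    rw [lt_div_iff₀ (by positivity)]
    norm_num
    linarith
  · exact (one_div_le (by positivity) (Nat.cast_pos.2 (Nat.ceil_pos.2 (by positivity)))).1
      (Nat.le_ceil _)
  · calc ⌈1 / (0.22 * σ)⌉₊ * σ ≤ (1 / (0.22 * σ) + 1) * σ := by
          gcongr
          exact (Nat.ceil_lt_add_one (by positivity)).le
      _ = 1 / 0.22 + σ := by field_simp
      _ ≤ 5.6 := by norm_num; linarith

theorem mul_div_le_grid_bound {K T σ N : ℝ} (hK : 2 ≤ K) (hT : 0 ≤ T) (hσT : σ ^ 2 * T = K - 1)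
    (hN : 5 ≤ N) (hNσ : 1 / N ≤ 0.22 * σ) (hσN : N * σ ≤ 5.6) :
    T * σ / 504 ≤ (N ^ 2 - 1) / (6 * N ^ 3) * (T / K * (K - 1 - (K / 8 + 5 * T / N ^ 2))) := by
  have hN0 : 0 < N := by linarith
  have gap : 0.16 / N ≤ (N ^ 2 - 1) / (6 * N ^ 3) := by
    rw [div_le_div_iff₀ hN0 (by positivity)]
    nlinarith [mul_nonneg hN0.le (show 0 ≤ N ^ 2 - 25 by nlinarith)]
  have information : 5 * T / N ^ 2 ≤ 0.242 * (K - 1) :=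
    calc 5 * T / N ^ 2 = 5 * T * (1 / N) ^ 2 := by ring
      _ ≤ 5 * T * (0.22 * σ) ^ 2 := by gcongr
      _ = 0.242 * (K - 1) := by rw [← hσT]; ring
  have missed_rounds : T / 4 ≤ T / K * (K - 1 - (K / 8 + 5 * T / N ^ 2)) :=
    calc T / 4 = T / K * (K / 4) := by field_simp
      _ ≤ T / K * (K - 1 - (K / 8 + 5 * T / N ^ 2)) := by gcongr; linarith
  calc T * σ / 504 ≤ 0.16 / N * (T / 4) := by
        rw [div_mul_eq_mul_div, le_div_iff₀ hN0]
        nlinarith [mul_le_mul_of_nonneg_left hσN hT]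
    _ ≤ (N ^ 2 - 1) / (6 * N ^ 3) * (T / K * (K - 1 - (K / 8 + 5 * T / N ^ 2))) :=
        mul_le_mul gap missed_rounds (by positivity) (le_trans (by positivity) gap)

theorem corollary4_general (K T : ℕ) (ρ : ℝ) (hK : 2 ≤ K) (hT : (K : ℝ) - 1 ≤ (T : ℝ))
    (hρ : 0.22 * Real.sqrt (((K : ℝ) - 1) / (T : ℝ)) ≤ ρ)
    {Ω : Type*} [MeasurableSpace Ω] (P : Measure Ω) [IsProbabilityMeasure P]
    (A : BanditAlgorithm K T Ω) :
    (∃ ℓ : Fin T → Fin K → ℝ, (∀ t, ℓ t ∈ lossesOfRange K ρ) ∧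
      Real.sqrt ((T : ℝ) * ((K : ℝ) - 1)) / 504 ≤ A.expectedRegret P ℓ) ∧
    Real.sqrt ((T : ℝ) * ((K : ℝ) - 1)) / 504 ≤
      ⨆ ℓ : {ℓ : Fin T → Fin K → ℝ // ∀ t, ℓ t ∈ lossesOfRange K ρ},
        A.expectedRegret P ℓ.1 := by
  have hK2 : (2 : ℝ) ≤ K := by exact_mod_cast hK
  have hT0 : (0 : ℝ) < T := by linarith
  have ratio_pos : 0 < ((K : ℝ) - 1) / T := div_pos (by linarith) hT0
  set σ := Real.sqrt (((K : ℝ) - 1) / T)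
  have hσT : σ ^ 2 * T = K - 1 := by rw [Real.sq_sqrt ratio_pos.le, div_mul_cancel₀ _ hT0.ne']
  have hσ : 0 < σ := Real.sqrt_pos.2 ratio_pos
  have rate : Real.sqrt ((T : ℝ) * ((K : ℝ) - 1)) = T * σ := by
    rw [← hσT, show (T : ℝ) * (σ ^ 2 * T) = (T * σ) ^ 2 by ring, Real.sqrt_sq (by positivity)]
  obtain ⟨N, hN, hNσ, hσN⟩ :=
    exists_grid_size hσ (Real.sqrt_le_one.2 ((div_le_one hT0).2 hT))
  obtain ⟨ℓ, hℓ, hregret⟩ :=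
    exists_lossesOfRange_le_expectedRegret (by omega) hN (hNσ.trans hρ) P A
  have hard : Real.sqrt ((T : ℝ) * ((K : ℝ) - 1)) / 504 ≤ A.expectedRegret P ℓ := by
    rw [rate]
    exact (mul_div_le_grid_bound hK2 hT0.le hσT (by exact_mod_cast hN) hNσ hσN).trans hregret
  exact ⟨⟨ℓ, hℓ, hard⟩, hard.trans (le_ciSup (A.bddAbove_expectedRegret P ρ) ⟨ℓ, hℓ⟩)⟩

theorem corollary4 (K T : ℕ) (ρ : ℝ) (hK : 2 ≤ K)
    (hT : 32 * ((K : ℝ) - 1) * Real.log 14 ≤ (T : ℝ))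
    (hρ : 0.22 * Real.sqrt (((K : ℝ) - 1) / (T : ℝ)) ≤ ρ)
    {Ω : Type*} [MeasurableSpace Ω] (P : Measure Ω) [IsProbabilityMeasure P]
    (A : BanditAlgorithm K T Ω) :
    (∃ ℓ : Fin T → Fin K → ℝ, (∀ t, ℓ t ∈ lossesOfRange K ρ) ∧
      Real.sqrt ((T : ℝ) * ((K : ℝ) - 1)) / 504 ≤ A.expectedRegret P ℓ) ∧
    Real.sqrt ((T : ℝ) * ((K : ℝ) - 1)) / 504 ≤
      ⨆ ℓ : {ℓ : Fin T → Fin K → ℝ // ∀ t, ℓ t ∈ lossesOfRange K ρ},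
        A.expectedRegret P ℓ.1 := by
  have hK2 : (2 : ℝ) ≤ K := by exact_mod_cast hK
  have hlog := Real.one_sub_inv_le_log_of_pos (show (0 : ℝ) < 14 by norm_num)
  exact corollary4_general K T ρ hK (by nlinarith) hρ P A
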